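/- Let $G$ be a finite simple graph with vertex set $V$. For $X,Y\subseteq V$ (not necessarily disjoint), let $e(X,Y)$ be the number of ordered pairs $(x,y)\in X\times Y$ with $xy$ an edge of $G$. For nonempty $X,Y$ let $d(X,Y)=e(X,Y)/(|X||Y|)$ and $$\operatorname{irreg}(X,Y)=\max_{U\subseteq X,\ W\subseteq Y}\bigl|e(U,W)-|U||W|\,d(X,Y)\bigr|.$$ For a partition $\mathcal P$ of $V$ into nonempty parts let $\operatorname{irreg}(\mathcal P)=\sum_{X,Y\in\mathcal P}\operatorname{irreg}(X,Y)$, the sum being over all ordered pairs of parts, including $X=Y$. A partition is equitable if the sizes of any two of its parts differ by at most one. Theorem. Let $0<\alpha<1/2$, let $m$ be a positive integer, and let $G$ be a graph on $n\ge 10^8m\alpha^{-5}$ vertices. If $\mathcal P$ is a partition of the vertex set of $G$ into $m$ parts, then there is an equitable partition $\mathcal Q$ of the vertex set of $G$ into at most $4m/\alpha$ parts such that $\operatorname{irreg}(\mathcal Q)\le\operatorname{irreg}(\mathcal P)+\alpha n^2$. -/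

import Mathlib

namespace SimpleGraph

variable {V : Type*} (G : SimpleGraph V) [DecidableRel G.Adj]

/-- The irregularity of a pair of vertex sets,
`irreg(X, Y) = max_{U ⊆ X, W ⊆ Y} |e(U, W) - |U| |W| d(X, Y)|`, where `e(U, W)` is the number of
ordered pairs in `U × W` that are edges and `d(X, Y) = e(X, Y) / (|X| |Y|)`. -/
noncomputable def pairIrreg (X Y : Finset V) : ℝ :=
  (X.powerset ×ˢ Y.powerset).sup'
    ⟨(∅, ∅), Finset.mem_product.2 ⟨Finset.empty_mem_powerset X, Finset.empty_mem_powerset Y⟩⟩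
    (fun p => |((G.interedges p.1 p.2).card : ℝ)
      - (p.1.card : ℝ) * (p.2.card : ℝ) * ((G.edgeDensity X Y : ℚ) : ℝ)|)

/-- The irregularity of a vertex partition: the sum of `irreg(X, Y)` over all ordered pairs of
(not necessarily distinct) parts. -/
noncomputable def partitionIrreg [Fintype V] [DecidableEq V]
    (P : Finpartition (Finset.univ : Finset V)) : ℝ :=
  ∑ X ∈ P.parts, ∑ Y ∈ P.parts, G.pairIrreg X Y

end SimpleGraph

/-! Start from an equitable partition with about `4m/α` parts in which each part of `P` is, up to
few vertices, a union of parts. A fixed choice could be bad, so its parts are shuffled by a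
uniformly random permutation preserving every part of `P`; the expected irregularity is bounded and
some permutation attains at most the mean.

The main point is that the cut norm survives sampling without replacement. For `S ⊆ X` and `T ⊆ Y`
disjoint, the random copy of `(S, T)` has expected irregularity at most about `|S||T|/(|X||Y|) ·
irreg(X, Y)`, with an error of order `|T|√|S| + |S|√|T|` (`expect_pairIrreg_map_le`). Summed over
all pairs, the main terms give back `irreg(P)`, and the errors are a small multiple of `αn²` once
the parts have size at least a large multiple of `α⁻²`. Equal pairs and parts straddling `P` are
few, and the bound `|S||T|/4` suffices for them.

For the sampling bound, the cut norm is a supremum, over signed row sets, of column sums of positive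
parts. Comparison with a ghost sample (`symmetrization`, `expect_perm_ciSup_le`) reduces it to a
Rademacher average; contraction (`rademacher_contraction`) removes the positive part, and a
second-moment bound gives `√|T|` per row. -/

open scoped BigOperators

/-! ### Rademacher averages: contraction and second moments. -/

section Rademacher

variable {ι β : Type*} [Finite ι] [Nonempty ι]

theorem ciSup_add_le_of_finite (f g : ι → ℝ) : ⨆ i, (f i + g i) ≤ (⨆ i, f i) + ⨆ i, g i :=
  ciSup_le fun i => add_le_add (le_ciSup (Set.finite_range f).bddAbove i)
    (le_ciSup (Set.finite_range g).bddAbove i)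

/-- If `i` and `j` attain the two suprema on the left, their sum is at most `C i + C j + |v i - v
j|`. The sign of `v i - v j` decides which index tests which supremum on the right. -/
theorem ciSup_add_add_ciSup_sub_le (C u v : ι → ℝ) (h : ∀ i j, |u i - u j| ≤ |v i - v j|) :
    (⨆ i, (C i + u i)) + (⨆ i, (C i - u i)) ≤ (⨆ i, (C i + v i)) + ⨆ i, (C i - v i) := by
  obtain ⟨i, hi⟩ := exists_eq_ciSup_of_finite (f := fun i => C i + u i)
  obtain ⟨j, hj⟩ := exists_eq_ciSup_of_finite (f := fun i => C i - u i)
  have h1 := fun k => le_ciSup (Set.finite_range fun i => C i + v i).bddAbove k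
  have h2 := fun k => le_ciSup (Set.finite_range fun i => C i - v i).bddAbove k
  rw [← hi, ← hj]
  have h3 := h1 i
  have h4 := h1 j
  have h5 := h2 i
  have h6 := h2 j
  have h7 := (le_abs_self _).trans (h i j)
  rcases abs_cases (v i - v j) with h8 | h8 <;> linarith

variable [DecidableEq β]

/-- Flipping the sign at one coordinate. -/
def flipSign (a : β) (ε : β → ℤˣ) : β → ℤˣ := ε * Pi.mulSingle a (-1)

theorem flipSign_self (a : β) (ε : β → ℤˣ) : flipSign a ε a = -ε a := by
  simp [flipSign]

theorem flipSign_of_ne {a y : β} (h : y ≠ a) (ε : β → ℤˣ) : flipSign a ε y = ε y := by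
  simp [flipSign, Pi.mulSingle_eq_of_ne h]

theorem sum_flipSign_of_notMem {a : β} {D : Finset β} (h : a ∉ D) (ε : β → ℤˣ) (b : β → ℝ) :
    ∑ y ∈ D, ((flipSign a ε y : ℤ) : ℝ) * b y = ∑ y ∈ D, ((ε y : ℤ) : ℝ) * b y :=
  Finset.sum_congr rfl fun y hy => by rw [flipSign_of_ne (ne_of_mem_of_not_mem hy h)]

variable [Fintype β]

theorem expect_flipSign (a : β) (F : (β → ℤˣ) → ℝ) : 𝔼 ε, F (flipSign a ε) = 𝔼 ε, F ε :=
  Fintype.expect_equiv (Equiv.mulRight (Pi.mulSingle a (-1))) _ _ fun _ => rfl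

theorem expect_le_of_add_flipSign_le (a : β) (F F' : (β → ℤˣ) → ℝ)
    (h : ∀ ε, F ε + F (flipSign a ε) ≤ F' ε + F' (flipSign a ε)) : 𝔼 ε, F ε ≤ 𝔼 ε, F' ε := by
  have h1 : 𝔼 ε, (F ε + F (flipSign a ε)) ≤ 𝔼 ε, (F' ε + F' (flipSign a ε)) :=
    Finset.expect_le_expect fun ε _ => h ε
  rw [Finset.expect_add_distrib, Finset.expect_add_distrib, expect_flipSign, expect_flipSign] at h1
  linarith

/-- The contraction principle for Rademacher averages. -/
theorem rademacher_contraction (f g : ι → β → ℝ)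
    (h : ∀ i j y, |f i y - f j y| ≤ |g i y - g j y|) (D : Finset β) :
    ∀ C : ι → (β → ℤˣ) → ℝ, (∀ i ε, ∀ a ∈ D, C i (flipSign a ε) = C i ε) →
    𝔼 ε, ⨆ i, (C i ε + ∑ y ∈ D, ((ε y : ℤ) : ℝ) * f i y) ≤
      𝔼 ε, ⨆ i, (C i ε + ∑ y ∈ D, ((ε y : ℤ) : ℝ) * g i y) := by
  induction D using Finset.induction_on with
  | empty => intro C _; simp
  | insert a D ha ih =>
    intro C hC
    have step1 : 𝔼 ε, ⨆ i, (C i ε + ∑ y ∈ insert a D, ((ε y : ℤ) : ℝ) * f i y) ≤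
        𝔼 ε, ⨆ i, ((C i ε + ((ε a : ℤ) : ℝ) * g i a) + ∑ y ∈ D, ((ε y : ℤ) : ℝ) * f i y) := by
      refine expect_le_of_add_flipSign_le a _ _ fun ε => ?_
      -- The sign vectors `ε` and `flipSign a ε` are treated together: only the term at `a` changes
      -- sign between them.
      have key := ciSup_add_add_ciSup_sub_le
        (fun i => C i ε + ∑ y ∈ D, ((ε y : ℤ) : ℝ) * f i y) (fun i => ((ε a : ℤ) : ℝ) * f i a)
        (fun i => ((ε a : ℤ) : ℝ) * g i a) (fun i j => by
          rw [← mul_sub, ← mul_sub, abs_mul, abs_mul]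
          exact mul_le_mul_of_nonneg_left (h i j a) (abs_nonneg _))
      convert key using 2
      · exact iSup_congr fun i => by rw [Finset.sum_insert ha]; ring
      · refine iSup_congr fun i => ?_
        rw [Finset.sum_insert ha, sum_flipSign_of_notMem ha, flipSign_self,
          hC i ε a (Finset.mem_insert_self a D)]
        push_cast; ring
      · exact iSup_congr fun i => by ring
      · refine iSup_congr fun i => ?_
        rw [sum_flipSign_of_notMem ha, flipSign_self, hC i ε a (Finset.mem_insert_self a D)]
        push_cast; ring
    -- The replaced term moves into the offset, which is why `C` may depend on `ε` outside `D`.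
    refine step1.trans ((ih _ fun i ε b hb => ?_).trans (le_of_eq ?_))
    · rw [hC i ε b (Finset.mem_insert_of_mem hb), flipSign_of_ne (ne_of_mem_of_not_mem hb ha).symm]
    · refine Finset.expect_congr rfl fun ε _ => iSup_congr fun i => ?_
      rw [Finset.sum_insert ha]; ring

theorem sq_expect_le {γ : Type*} [Fintype γ] [Nonempty γ] (F : γ → ℝ) :
    (𝔼 c, F c) ^ 2 ≤ 𝔼 c, F c ^ 2 := by
  have h : 0 ≤ 𝔼 c, (F c - 𝔼 d, F d) ^ 2 := Finset.expect_nonneg fun _ _ => sq_nonneg _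
  have h2 : 𝔼 c, (F c - 𝔼 d, F d) ^ 2 = (𝔼 c, F c ^ 2) - (𝔼 d, F d) ^ 2 := by
    have : ∀ c, (F c - 𝔼 d, F d) ^ 2 = F c ^ 2 - F c * (2 * 𝔼 d, F d) + (𝔼 d, F d) ^ 2 :=
      fun c => by ring
    simp_rw [this]
    rw [Finset.expect_add_distrib, Finset.expect_sub_distrib, ← Finset.expect_mul,
      Fintype.expect_const]
    ring
  linarith

/-- Averaging over a flip at `a` kills the cross term between `a` and the other coordinates. -/
theorem expect_sq_rademacher (b : β → ℝ) (D : Finset β) :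
    𝔼 ε : β → ℤˣ, (∑ y ∈ D, ((ε y : ℤ) : ℝ) * b y) ^ 2 = ∑ y ∈ D, b y ^ 2 := by
  induction D using Finset.induction_on with
  | empty => simp
  | insert a D ha ih =>
    have hs : ∀ u : ℤˣ, ((u : ℤ) : ℝ) ^ 2 = 1 := fun u => by
      rcases Int.units_eq_one_or u with rfl | rfl <;> simp
    have : 𝔼 ε : β → ℤˣ, (∑ y ∈ insert a D, ((ε y : ℤ) : ℝ) * b y) ^ 2 =
        𝔼 ε : β → ℤˣ, (b a ^ 2 + (∑ y ∈ D, ((ε y : ℤ) : ℝ) * b y) ^ 2) := by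
      apply le_antisymm <;>
      · refine expect_le_of_add_flipSign_le a _ _ fun ε => le_of_eq ?_
        rw [Finset.sum_insert ha, Finset.sum_insert ha, sum_flipSign_of_notMem ha, flipSign_self]
        push_cast
        have := hs (ε a)
        first
          | linear_combination (2 * b a ^ 2) * this
          | linear_combination (-2 * b a ^ 2) * this
    rw [this, Finset.expect_add_distrib, ih, Fintype.expect_const, Finset.sum_insert ha]

theorem expect_abs_rademacher_le (b : β → ℝ) (hb : ∀ y, |b y| ≤ 1) (D : Finset β) :
    𝔼 ε : β → ℤˣ, |∑ y ∈ D, ((ε y : ℤ) : ℝ) * b y| ≤ √(D.card : ℝ) := by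
  apply Real.le_sqrt_of_sq_le
  refine (sq_expect_le _).trans ?_
  simp_rw [sq_abs]
  rw [expect_sq_rademacher]
  refine (Finset.sum_le_sum fun y _ => (sq_le_one_iff_abs_le_one _).2 (hb y)).trans ?_
  simp

end Rademacher

/-! ### Sampling without replacement by random permutations. -/

section Sampling

variable {β : Type*} [DecidableEq β]

theorem exists_involutive_swap (D D' : Finset β) (hd : Disjoint D D') (hc : D.card = D'.card) :
    ∃ κ : β → β, Function.Involutive κ ∧ D.image κ = D' := by
  let e : D ≃ D' := Finset.equivOfCardEq hc
  have hn : ∀ y ∈ D', y ∉ D := fun y h h' => Finset.disjoint_left.1 hd h' h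
  let κ : β → β := fun y => if h : y ∈ D then e ⟨y, h⟩ else
    if h : y ∈ D' then e.symm ⟨y, h⟩ else y
  have h1 : ∀ y (h : y ∈ D), κ y = e ⟨y, h⟩ := fun y h => by simp [κ, h]
  have h2 : ∀ y (h : y ∈ D'), κ y = e.symm ⟨y, h⟩ := fun y h => by simp [κ, h, hn y h]
  refine ⟨κ, fun y => ?_, ?_⟩
  · by_cases h : y ∈ D
    · rw [h1 y h, h2 _ (e ⟨y, h⟩).2]; simp
    · by_cases h' : y ∈ D'
      · rw [h2 y h', h1 _ (e.symm ⟨y, h'⟩).2]; simp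
      · simp [κ, h, h']
  · apply Finset.eq_of_subset_of_card_le
    · intro y hy
      obtain ⟨x, hx, rfl⟩ := Finset.mem_image.1 hy
      rw [h1 x hx]; exact (e ⟨x, hx⟩).2
    · rw [Finset.card_image_of_injOn, hc]
      intro x hx y hy hxy
      rw [h1 x hx, h1 y hy] at hxy
      simpa using hxy

/-- The involution `κ`, restricted to the pairs `{y, κ y}` with `y ∈ D` and `ε y = -1`. -/
theorem exists_perm_of_signs (D : Finset β) (κ : β → β) (hκ : Function.Involutive κ)
    (hD : ∀ y ∈ D, κ y ∉ D) (ε : β → ℤˣ) :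
    ∃ θ : Equiv.Perm β, ∀ y ∈ D, (ε y = 1 → θ y = y ∧ θ (κ y) = κ y) ∧
      (ε y = -1 → θ y = κ y ∧ θ (κ y) = y) := by
  -- The signs are copied from `D` to its mirror image, so that `s` is `κ`-invariant and `θ` is an
  -- involution.
  let s : β → ℤˣ := fun y => if y ∈ D then ε y else if κ y ∈ D then ε (κ y) else 1
  have hs : ∀ y, s (κ y) = s y := fun y => by
    by_cases h : y ∈ D
    · simp [s, h, hD y h, hκ y]
    · by_cases h' : κ y ∈ D <;> simp [s, h, h', hκ y]
  have hsD : ∀ y ∈ D, s y = ε y := fun y h => by simp [s, h]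
  let θ : β → β := fun y => if s y = -1 then κ y else y
  have hθ : Function.Involutive θ := fun y => by
    by_cases h : s y = -1
    · simp [θ, h, hs, hκ y]
    · simp [θ, h]
  refine ⟨hθ.toPerm θ, fun y hy => ⟨fun h => ?_, fun h => ?_⟩⟩
  · have : s y = 1 := (hsD y hy).trans h
    simp [θ, hs, this, show (1 : ℤˣ) ≠ -1 by decide]
  · have : s y = -1 := (hsD y hy).trans h
    simp [θ, hs, this, hκ y]

variable [Fintype β]

theorem expect_perm_mul_right (θ : Equiv.Perm β) (F : Equiv.Perm β → ℝ) :
    𝔼 τ : Equiv.Perm β, F (τ * θ) = 𝔼 τ : Equiv.Perm β, F τ :=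
  Fintype.expect_equiv (Equiv.mulRight θ) _ _ fun _ => rfl

theorem expect_perm_apply (g : β → ℝ) (y : β) :
    𝔼 τ : Equiv.Perm β, g (τ y) = 𝔼 x, g x := by
  have : ∀ z, 𝔼 τ : Equiv.Perm β, g (τ y) = 𝔼 τ : Equiv.Perm β, g (τ z) := fun z => by
    rw [← expect_perm_mul_right (Equiv.swap y z) fun τ => g (τ y)]
    simp
  have hne : Nonempty β := ⟨y⟩
  rw [← Fintype.expect_const (ι := β) (𝔼 τ : Equiv.Perm β, g (τ y)),
    Finset.expect_congr rfl fun z _ => this z, Finset.expect_comm]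
  rw [← Fintype.expect_const (ι := Equiv.Perm β) (𝔼 x, g x)]
  exact Finset.expect_congr rfl fun τ _ => Fintype.expect_equiv τ _ _ fun _ => rfl

theorem expect_perm_sum (g : β → ℝ) (T : Finset β) :
    𝔼 τ : Equiv.Perm β, ∑ y ∈ T, g (τ y) = (T.card : ℝ) / Fintype.card β * ∑ y, g y := by
  rw [Finset.expect_sum_comm, Finset.sum_congr rfl fun y _ => expect_perm_apply g y,
    Finset.sum_const, Fintype.expect_eq_sum_div_card, nsmul_eq_mul]
  ring

variable {ι : Type*} [Finite ι] [Nonempty ι]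

/-- Symmetrization: exchanging `D` with `κ D` by random signs. -/
theorem symmetrization (f : ι → β → ℝ) (D : Finset β) (κ : β → β) (hκ : Function.Involutive κ)
    (hD : ∀ y ∈ D, κ y ∉ D) (R : ℝ)
    (hR : ∀ τ : Equiv.Perm β,
      𝔼 ε : β → ℤˣ, ⨆ i, ∑ y ∈ D, ((ε y : ℤ) : ℝ) * f i (τ y) ≤ R) :
    𝔼 τ : Equiv.Perm β, ⨆ i, ∑ y ∈ D, (f i (τ y) - f i (τ (κ y))) ≤ 2 * R := by
  choose θ hθ using exists_perm_of_signs D κ hκ hD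
  have h1 : ∀ ε : β → ℤˣ, 𝔼 τ : Equiv.Perm β, ⨆ i, ∑ y ∈ D, (f i (τ y) - f i (τ (κ y))) =
      𝔼 τ : Equiv.Perm β, ⨆ i, ∑ y ∈ D, ((ε y : ℤ) : ℝ) * (f i (τ y) - f i (τ (κ y))) := by
    intro ε
    -- Composing with `θ ε` keeps `τ` uniform and exchanges `y` with `κ y` exactly where `ε y = -1`,
    -- which negates that summand.
    rw [← expect_perm_mul_right (θ ε)]
    refine Finset.expect_congr rfl fun τ _ => iSup_congr fun i =>
      Finset.sum_congr rfl fun y hy => ?_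
    rcases Int.units_eq_one_or (ε y) with h | h
    · obtain ⟨h2, h3⟩ := (hθ ε y hy).1 h
      simp [h2, h3, h]
    · obtain ⟨h2, h3⟩ := (hθ ε y hy).2 h
      simp [h2, h3, h]
  rw [← Fintype.expect_const (ι := β → ℤˣ)
    (𝔼 τ : Equiv.Perm β, ⨆ i, ∑ y ∈ D, (f i (τ y) - f i (τ (κ y)))),
    Finset.expect_congr rfl fun ε _ => h1 ε, Finset.expect_comm]
  rw [← Fintype.expect_const (ι := Equiv.Perm β) (2 * R)]
  refine Finset.expect_le_expect fun τ _ => ?_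
  have h2 : ∀ ε : β → ℤˣ, ⨆ i, ∑ y ∈ D, ((ε y : ℤ) : ℝ) * (f i (τ y) - f i (τ (κ y))) ≤
      (⨆ i, ∑ y ∈ D, ((ε y : ℤ) : ℝ) * f i (τ y)) +
      ⨆ i, ∑ y ∈ D, (((-ε) y : ℤ) : ℝ) * f i (τ (κ y)) := fun ε => by
    refine le_trans (le_of_eq ?_) (ciSup_add_le_of_finite _ _)
    refine iSup_congr fun i => ?_
    rw [← Finset.sum_add_distrib]
    refine Finset.sum_congr rfl fun y _ => ?_
    simp; ring
  refine (Finset.expect_le_expect fun ε _ => h2 ε).trans ?_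
  rw [Finset.expect_add_distrib, two_mul]
  refine add_le_add (hR τ) (le_trans (le_of_eq ?_) (hR (τ * hκ.toPerm κ)))
  exact Fintype.expect_equiv (Equiv.neg (β → ℤˣ)) _ _ fun _ => rfl

/-- Sampling without replacement: the supremum of a finite family of sums over a random set
exceeds the supremum of the scaled full sums by at most twice a Rademacher average. -/
theorem expect_perm_ciSup_le (f : ι → β → ℝ) (T : Finset β) (R : ℝ)
    (hR : ∀ τ : Equiv.Perm β, ∀ D ⊆ T,
      𝔼 ε : β → ℤˣ, ⨆ i, ∑ y ∈ D, ((ε y : ℤ) : ℝ) * f i (τ y) ≤ R) :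
    𝔼 τ : Equiv.Perm β, ⨆ i, ∑ y ∈ T, f i (τ y) ≤
      (T.card : ℝ) / Fintype.card β * (⨆ i, ∑ y, f i y) + 2 * R := by
  have hfix : ∀ ρ : Equiv.Perm β,
      𝔼 τ : Equiv.Perm β, ⨆ i, (∑ y ∈ T, f i (τ y) - ∑ y ∈ T, f i (τ (ρ y))) ≤ 2 * R := by
    intro ρ
    -- `T'` is the ghost sample. The sums over `T` and `T'` agree on the overlap, leaving two
    -- disjoint sets of equal size to exchange; this is why `hR` is needed for all `D ⊆ T`.
    set T' := T.image ρ with hT'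
    have hc : (T \ T').card = (T' \ T).card := by
      have h1 := Finset.card_sdiff_add_card_inter T T'
      have h2 := Finset.card_sdiff_add_card_inter T' T
      have h3 : T'.card = T.card := Finset.card_image_of_injective _ ρ.injective
      rw [Finset.inter_comm] at h2
      omega
    obtain ⟨κ, hκ, hκD⟩ := exists_involutive_swap (T \ T') (T' \ T)
      (Finset.disjoint_left.2 fun y h h' => by simp at h h'; tauto) hc
    have := symmetrization f (T \ T') κ hκ (fun y hy h => by
      have : κ y ∈ T' \ T := hκD ▸ Finset.mem_image_of_mem κ hy
      simp at this h; tauto) R fun τ => hR τ _ Finset.sdiff_subset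
    refine le_trans (le_of_eq ?_) this
    refine Finset.expect_congr rfl fun τ _ => iSup_congr fun i => ?_
    have e1 : ∑ y ∈ T, f i (τ (ρ y)) = ∑ y ∈ T', f i (τ y) :=
      (Finset.sum_image (f := fun y => f i (τ y)) fun a _ b _ h => ρ.injective h).symm
    have e2 : ∑ y ∈ T \ T', f i (τ (κ y)) = ∑ y ∈ T' \ T, f i (τ y) := by
      rw [← hκD]; exact (Finset.sum_image (f := fun y => f i (τ y)) fun a _ b _ h => hκ.injective h).symm
    rw [e1, Finset.sum_sub_distrib, e2, ← Finset.sum_sdiff_sub_sum_sdiff]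
  have h1 : ∀ τ : Equiv.Perm β, ⨆ i, ∑ y ∈ T, f i (τ y) ≤
      (T.card : ℝ) / Fintype.card β * (⨆ i, ∑ y, f i y) +
        𝔼 ρ : Equiv.Perm β, ⨆ i, (∑ y ∈ T, f i (τ y) - ∑ y ∈ T, f i (τ (ρ y))) := by
    intro τ
    refine ciSup_le fun i => ?_
    have h2 : 𝔼 ρ : Equiv.Perm β, (∑ y ∈ T, f i (τ y) - ∑ y ∈ T, f i (τ (ρ y))) ≤
        𝔼 ρ : Equiv.Perm β, ⨆ i, (∑ y ∈ T, f i (τ y) - ∑ y ∈ T, f i (τ (ρ y))) :=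
      Finset.expect_le_expect fun ρ _ => le_ciSup
        (f := fun i => ∑ y ∈ T, f i (τ y) - ∑ y ∈ T, f i (τ (ρ y)))
        (Set.finite_range _).bddAbove i
    -- Averaged over `ρ`, the ghost sum becomes the scaled full sum.
    rw [Finset.expect_sub_distrib, Fintype.expect_const, expect_perm_sum (fun y => f i (τ y)),
      Equiv.sum_comp τ (f i)] at h2
    have h3 : (T.card : ℝ) / Fintype.card β * (∑ y, f i y) ≤
        (T.card : ℝ) / Fintype.card β * (⨆ i, ∑ y, f i y) :=
      mul_le_mul_of_nonneg_left
        (le_ciSup (f := fun i => ∑ y, f i y) (Set.finite_range _).bddAbove i) (by positivity)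
    linarith
  refine (Finset.expect_le_expect fun τ _ => h1 τ).trans ?_
  rw [Finset.expect_add_distrib, Fintype.expect_const, Finset.expect_comm]
  refine add_le_add le_rfl ?_
  rw [← Fintype.expect_const (ι := Equiv.Perm β) (2 * R)]
  exact Finset.expect_le_expect fun ρ _ => hfix ρ

/-- Sampling columns of a bounded matrix. -/
theorem expect_perm_ciSup_matrix_le {α : Type*} (S : Finset α) (T : Finset β) (B : α → β → ℝ)
    (hB : ∀ x y, |B x y| ≤ 1) (c : ι → α → ℝ) (hc : ∀ i x, |c i x| ≤ 1) (ψ : ℝ → ℝ)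
    (hψ : ∀ a b, |ψ a - ψ b| ≤ |a - b|) :
    𝔼 τ : Equiv.Perm β, ⨆ i, ∑ y ∈ T, ψ (∑ x ∈ S, c i x * B x (τ y)) ≤
      (T.card : ℝ) / Fintype.card β * (⨆ i, ∑ y, ψ (∑ x ∈ S, c i x * B x y)) +
        2 * (S.card * √(T.card : ℝ)) := by
  refine expect_perm_ciSup_le (fun i y => ψ (∑ x ∈ S, c i x * B x y)) T _ fun τ D hD => ?_
  have h1 := rademacher_contraction (fun i y => ψ (∑ x ∈ S, c i x * B x (τ y)))
    (fun i y => ∑ x ∈ S, c i x * B x (τ y)) (fun i j y => hψ _ _) D (fun _ _ => 0) (by simp)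
  simp only [zero_add] at h1
  refine h1.trans ?_
  -- With `ψ` removed the sum is linear in `c i`, and `|c i x| ≤ 1` bounds the supremum by a sum
  -- over rows that no longer involves `i`.
  have h2 : ∀ ε : β → ℤˣ, ⨆ i, ∑ y ∈ D, ((ε y : ℤ) : ℝ) * (∑ x ∈ S, c i x * B x (τ y)) ≤
      ∑ x ∈ S, |∑ y ∈ D, ((ε y : ℤ) : ℝ) * B x (τ y)| := by
    intro ε
    refine ciSup_le fun i => ?_
    have : ∑ y ∈ D, ((ε y : ℤ) : ℝ) * (∑ x ∈ S, c i x * B x (τ y)) =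
        ∑ x ∈ S, c i x * ∑ y ∈ D, ((ε y : ℤ) : ℝ) * B x (τ y) := by
      simp_rw [Finset.mul_sum]
      rw [Finset.sum_comm]
      exact Finset.sum_congr rfl fun x _ => Finset.sum_congr rfl fun y _ => by ring
    rw [this]
    refine Finset.sum_le_sum fun x _ => (le_abs_self _).trans ?_
    rw [abs_mul]
    exact mul_le_of_le_one_left (abs_nonneg _) (hc i x)
  refine (Finset.expect_le_expect fun ε _ => h2 ε).trans ?_
  rw [Finset.expect_sum_comm, ← nsmul_eq_mul]
  refine Finset.sum_le_card_nsmul _ _ _ fun x _ => ?_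
  refine (expect_abs_rademacher_le _ (fun y => hB x (τ y)) D).trans ?_
  exact Real.sqrt_le_sqrt (by exact_mod_cast Finset.card_le_card hD)

end Sampling

/-! ### The cut norm and its behaviour under column sampling. -/

section CutNorm

variable {α β γ : Type*}

/-- The cut norm of the submatrix of `B` with rows `S` and columns `T`. -/
noncomputable def cutNorm (B : α → β → ℝ) (S : Finset α) (T : Finset β) : ℝ :=
  (S.powerset ×ˢ T.powerset).sup'
    ⟨(∅, ∅), Finset.mem_product.2 ⟨Finset.empty_mem_powerset S, Finset.empty_mem_powerset T⟩⟩
    (fun p => |∑ x ∈ p.1, ∑ y ∈ p.2, B x y|)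

theorem le_cutNorm (B : α → β → ℝ) {S U : Finset α} {T W : Finset β} (hU : U ⊆ S) (hW : W ⊆ T) :
    |∑ x ∈ U, ∑ y ∈ W, B x y| ≤ cutNorm B S T :=
  Finset.le_sup' (fun p : Finset α × Finset β => |∑ x ∈ p.1, ∑ y ∈ p.2, B x y|)
    (b := (U, W)) (by simp [hU, hW])

theorem cutNorm_le {B : α → β → ℝ} {S : Finset α} {T : Finset β} {r : ℝ}
    (h : ∀ U ⊆ S, ∀ W ⊆ T, |∑ x ∈ U, ∑ y ∈ W, B x y| ≤ r) : cutNorm B S T ≤ r := by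
  refine Finset.sup'_le _ _ fun p hp => ?_
  simp only [Finset.mem_product, Finset.mem_powerset] at hp
  exact h _ hp.1 _ hp.2

theorem cutNorm_nonneg (B : α → β → ℝ) (S : Finset α) (T : Finset β) : 0 ≤ cutNorm B S T :=
  (abs_nonneg _).trans (le_cutNorm B (Finset.Subset.refl S) (Finset.Subset.refl T))

theorem cutNorm_mono_right (B : α → β → ℝ) (S : Finset α) {T T' : Finset β} (h : T ⊆ T') :
    cutNorm B S T ≤ cutNorm B S T' :=
  cutNorm_le fun _ hU _ hW => le_cutNorm B hU (hW.trans h)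

theorem cutNorm_congr {B B' : α → β → ℝ} {S : Finset α} {T : Finset β}
    (h : ∀ x ∈ S, ∀ y ∈ T, B x y = B' x y) : cutNorm B S T = cutNorm B' S T := by
  apply le_antisymm
  · refine cutNorm_le fun U hU W hW => ?_
    rw [Finset.sum_congr rfl fun x hx => Finset.sum_congr rfl fun y hy => h x (hU hx) y (hW hy)]
    exact le_cutNorm B' hU hW
  · refine cutNorm_le fun U hU W hW => ?_
    rw [← Finset.sum_congr rfl fun x hx => Finset.sum_congr rfl fun y hy => h x (hU hx) y (hW hy)]
    exact le_cutNorm B hU hW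

theorem cutNorm_transpose (B : α → β → ℝ) (S : Finset α) (T : Finset β) :
    cutNorm (fun y x => B x y) T S = cutNorm B S T := by
  apply le_antisymm
  · refine cutNorm_le fun U hU W hW => ?_
    rw [Finset.sum_comm]
    exact le_cutNorm B hW hU
  · refine cutNorm_le fun U hU W hW => ?_
    rw [Finset.sum_comm]
    exact le_cutNorm (fun y x => B x y) hW hU

theorem cutNorm_map_right (B : α → β → ℝ) (S : Finset α) (T : Finset γ) (e : γ ↪ β) :
    cutNorm B S (T.map e) = cutNorm (fun x y => B x (e y)) S T := by
  apply le_antisymm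
  · refine cutNorm_le fun U hU W hW => ?_
    obtain ⟨W', hW', rfl⟩ := Finset.subset_map_iff.1 hW
    simp only [Finset.sum_map]
    exact le_cutNorm (fun x y => B x (e y)) hU hW'
  · refine cutNorm_le fun U hU W hW => ?_
    simpa only [Finset.sum_map] using le_cutNorm B hU (Finset.map_subset_map (f := e).2 hW)

theorem cutNorm_map_left (B : α → β → ℝ) (S : Finset γ) (T : Finset β) (e : γ ↪ α) :
    cutNorm B (S.map e) T = cutNorm (fun x y => B (e x) y) S T := by
  rw [← cutNorm_transpose, cutNorm_map_right, ← cutNorm_transpose]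

/-- The cut norm as a supremum over signed row sets only. -/
theorem cutNorm_eq_ciSup [DecidableEq α] (B : α → β → ℝ) (S : Finset α) (T : Finset β) :
    cutNorm B S T = ⨆ i : S.powerset × ℤˣ, ∑ y ∈ T,
      max (∑ x ∈ S, (if x ∈ i.1.1 then ((i.2 : ℤ) : ℝ) else 0) * B x y) 0 := by
  have hrow : ∀ (U : Finset α) (_ : U ⊆ S) (s : ℤˣ) (y : β),
      ∑ x ∈ S, (if x ∈ U then ((s : ℤ) : ℝ) else 0) * B x y = ((s : ℤ) : ℝ) * ∑ x ∈ U, B x y := by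
    intro U hU s y
    simp only [ite_mul, zero_mul]
    rw [← Finset.sum_filter, Finset.filter_mem_eq_inter, Finset.inter_eq_right.2 hU,
      Finset.mul_sum]
  have hs : ∀ s : ℤˣ, |((s : ℤ) : ℝ)| = 1 := fun u => by
    rcases Int.units_eq_one_or u with rfl | rfl <;> simp
  have hne : Nonempty S.powerset := ⟨⟨∅, Finset.empty_mem_powerset S⟩⟩
  apply le_antisymm
  · refine cutNorm_le fun U hU W hW => ?_
    obtain ⟨s, hs'⟩ : ∃ s : ℤˣ, |∑ x ∈ U, ∑ y ∈ W, B x y| =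
        ((s : ℤ) : ℝ) * ∑ x ∈ U, ∑ y ∈ W, B x y := by
      rcases abs_choice (∑ x ∈ U, ∑ y ∈ W, B x y) with h | h
      · exact ⟨1, by simp [h]⟩
      · exact ⟨-1, by simp [h]⟩
    rw [hs', Finset.sum_comm, Finset.mul_sum]
    refine le_trans ?_ (le_ciSup (Set.finite_range _).bddAbove
      ((⟨U, Finset.mem_powerset.2 hU⟩, s) : S.powerset × ℤˣ))
    dsimp only
    simp only [hrow U hU]
    exact (Finset.sum_le_sum fun y _ => le_max_left _ 0).trans
      (Finset.sum_le_sum_of_subset_of_nonneg hW fun _ _ _ => le_max_right _ _)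
  · refine ciSup_le fun i => ?_
    obtain ⟨⟨U, hU⟩, s⟩ := i
    rw [Finset.mem_powerset] at hU
    simp only [hrow U hU]
    -- For a fixed signed row set, the optimal columns are those whose signed sum is nonnegative.
    have h1 : ∑ y ∈ T, max (((s : ℤ) : ℝ) * ∑ x ∈ U, B x y) 0 =
        ((s : ℤ) : ℝ) * ∑ x ∈ U, ∑ y ∈ T with 0 ≤ ((s : ℤ) : ℝ) * ∑ x ∈ U, B x y, B x y := by
      rw [Finset.sum_comm, Finset.mul_sum, Finset.sum_filter]
      refine Finset.sum_congr rfl fun y _ => ?_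
      split_ifs with h
      · exact max_eq_left h
      · exact max_eq_right (le_of_not_ge h)
    rw [h1]
    refine (le_abs_self _).trans ?_
    rw [abs_mul, hs, one_mul]
    exact le_cutNorm B hU (Finset.filter_subset _ _)

theorem abs_eq_ciSup_units (z : ℝ) : |z| = ⨆ s : ℤˣ, ((s : ℤ) : ℝ) * z := by
  apply le_antisymm
  · rcases abs_choice z with h | h
    · rw [h]
      exact le_trans (by simp) (le_ciSup (Set.finite_range _).bddAbove (1 : ℤˣ))
    · rw [h]
      exact le_trans (by simp) (le_ciSup (Set.finite_range _).bddAbove (-1 : ℤˣ))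
  · refine ciSup_le fun s => ?_
    rcases Int.units_eq_one_or s with rfl | rfl
    · simpa using le_abs_self z
    · simpa using neg_le_abs z

variable [Fintype β] [DecidableEq β]

theorem expect_perm_cutNorm_le (B : α → β → ℝ) (hB : ∀ x y, |B x y| ≤ 1) (S : Finset α)
    (T : Finset β) :
    𝔼 τ : Equiv.Perm β, cutNorm (fun x y => B x (τ y)) S T ≤
      (T.card : ℝ) / Fintype.card β * cutNorm B S Finset.univ + 2 * (S.card * √(T.card : ℝ)) := by
  classical
  have hne : Nonempty S.powerset := ⟨⟨∅, Finset.empty_mem_powerset S⟩⟩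
  simp only [cutNorm_eq_ciSup]
  refine expect_perm_ciSup_matrix_le S T B hB
    (fun (i : S.powerset × ℤˣ) x => if x ∈ i.1.1 then ((i.2 : ℤ) : ℝ) else 0) (fun i x => ?_)
    (fun z => max z 0) (fun a b => abs_max_sub_max_le_abs a b 0)
  rcases Int.units_eq_one_or i.2 with h | h <;> split_ifs <;> simp [h]

theorem expect_perm_abs_sum_le (B : α → β → ℝ) (hB : ∀ x y, |B x y| ≤ 1) (S : Finset α)
    (T : Finset β) :
    𝔼 τ : Equiv.Perm β, |∑ x ∈ S, ∑ y ∈ T, B x (τ y)| ≤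
      (T.card : ℝ) / Fintype.card β * |∑ x ∈ S, ∑ y, B x y| +
        2 * (S.card * √(T.card : ℝ)) := by
  have key := expect_perm_ciSup_matrix_le S T B hB
    (fun (s : ℤˣ) _ => ((s : ℤ) : ℝ)) (fun s x => by
      rcases Int.units_eq_one_or s with rfl | rfl <;> simp) id (fun a b => le_rfl)
  have h : ∀ (T : Finset β) (τ : Equiv.Perm β), |∑ x ∈ S, ∑ y ∈ T, B x (τ y)| =
      ⨆ s : ℤˣ, ∑ y ∈ T, id (∑ x ∈ S, ((s : ℤ) : ℝ) * B x (τ y)) := fun T τ => by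
    rw [abs_eq_ciSup_units]
    refine iSup_congr fun s => ?_
    simp only [id, ← Finset.mul_sum]
    rw [Finset.sum_comm]
  have h1 := h Finset.univ 1
  simp only [Equiv.Perm.one_apply] at h1
  rw [h1]
  simpa only [h] using key

end CutNorm

/-! ### Random permutations preserving a colouring. -/

section ColourPreserving

variable {V κ α : Type*}

theorem map_subtype_univ (Y : Finset V) :
    (Finset.univ : Finset Y).map (Function.Embedding.subtype (· ∈ Y)) = Y := by
  ext; simp

variable [DecidableEq V]

theorem map_subtype_eq {T Y : Finset V} (h : T ⊆ Y) :
    (T.subtype (· ∈ Y)).map (Function.Embedding.subtype (· ∈ Y)) = T :=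
  Finset.subtype_map_of_mem fun _ hx => h hx

theorem card_subtype_of_subset {T Y : Finset V} (h : T ⊆ Y) :
    (T.subtype (· ∈ Y)).card = T.card := by
  conv_rhs => rw [← map_subtype_eq h, Finset.card_map]

variable [Fintype V] [DecidableEq κ]

/-- The permutations preserving a colouring. -/
def colourPerms (p : V → κ) : Finset (Equiv.Perm V) :=
  Finset.univ.filter fun σ => ∀ v, p (σ v) = p v

theorem colourPerms_nonempty (p : V → κ) : (colourPerms p).Nonempty :=
  ⟨1, by simp [colourPerms]⟩

theorem expect_colourPerms_mul {p : V → κ} {θ : Equiv.Perm V} (hθ : θ ∈ colourPerms p)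
    (F : Equiv.Perm V → ℝ) :
    𝔼 σ ∈ colourPerms p, F (σ * θ) = 𝔼 σ ∈ colourPerms p, F σ := by
  refine Finset.expect_equiv (Equiv.mulRight θ) (fun σ => ?_) fun _ _ => rfl
  simp only [colourPerms, Finset.mem_filter, Finset.mem_univ, true_and, Equiv.coe_mulRight,
    Equiv.Perm.mul_apply] at hθ ⊢
  constructor
  · intro h v
    rw [h, hθ]
  · intro h v
    have h1 := h (θ.symm v)
    have h2 := hθ (θ.symm v)
    simp only [Equiv.apply_symm_apply] at h1 h2
    rw [h1, h2]

theorem ofSubtype_mem_colourPerms {p : V → κ} {Y : Finset V}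
    (hY : ∀ y ∈ Y, ∀ y' ∈ Y, p y = p y') (τ : Equiv.Perm Y) :
    Equiv.Perm.ofSubtype τ ∈ colourPerms p := by
  simp only [colourPerms, Finset.mem_filter, Finset.mem_univ, true_and]
  intro v
  by_cases hv : v ∈ Y
  · rw [Equiv.Perm.ofSubtype_apply_of_mem τ hv]
    exact hY _ (τ ⟨v, hv⟩).2 _ hv
  · rw [Equiv.Perm.ofSubtype_apply_of_not_mem τ hv]

/-- A fresh shuffle of a monochromatic set `Y` does not change the distribution of `σ`. This plays
the role of conditioning on `σ` outside `Y`. -/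
theorem expect_colourPerms_eq {p : V → κ} {Y : Finset V}
    (hY : ∀ y ∈ Y, ∀ y' ∈ Y, p y = p y') (F : Equiv.Perm V → ℝ) :
    𝔼 σ ∈ colourPerms p, F σ =
      𝔼 σ ∈ colourPerms p, 𝔼 τ : Equiv.Perm Y, F (σ * Equiv.Perm.ofSubtype τ) := by
  rw [Finset.expect_comm, Finset.expect_congr rfl fun τ _ =>
    expect_colourPerms_mul (ofSubtype_mem_colourPerms hY τ) F, Fintype.expect_const]

/-- The matrix may depend on `σ`, so its rows may already be permuted; `hBτ` asks only that a
reshuffle of `Y` act on columns alone. -/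
theorem expect_colourPerms_cutNorm_le {p : V → κ} {S : Finset α} {T Y : Finset V}
    (hY : ∀ y ∈ Y, ∀ y' ∈ Y, p y = p y') (hT : T ⊆ Y) (B : Equiv.Perm V → α → V → ℝ)
    (hB : ∀ σ x y, |B σ x y| ≤ 1)
    (hBτ : ∀ σ (τ : Equiv.Perm Y), ∀ x ∈ S, ∀ y ∈ Y, B (σ * Equiv.Perm.ofSubtype τ) x y =
      B σ x (Equiv.Perm.ofSubtype τ y)) :
    𝔼 σ ∈ colourPerms p, cutNorm (B σ) S T ≤
      (T.card : ℝ) / Y.card * (𝔼 σ ∈ colourPerms p, cutNorm (B σ) S Y) +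
        2 * (S.card * √(T.card : ℝ)) := by
  rw [expect_colourPerms_eq hY, Finset.mul_expect]
  rw [← Finset.expect_const (colourPerms_nonempty p) (2 * (S.card * √(T.card : ℝ))),
    ← Finset.expect_add_distrib]
  refine Finset.expect_le_expect fun σ _ => ?_
  have key := expect_perm_cutNorm_le (fun x (y : Y) => B σ x y) (fun x y => hB σ x y) S
    (T.subtype (· ∈ Y))
  rw [card_subtype_of_subset hT, Fintype.card_coe] at key
  have h1 : cutNorm (fun x (y : Y) => B σ x y) S Finset.univ = cutNorm (B σ) S Y := by
    conv_rhs => rw [← map_subtype_univ Y, cutNorm_map_right]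
    rfl
  rw [h1] at key
  refine le_trans (le_of_eq ?_) key
  refine Finset.expect_congr rfl fun τ _ => ?_
  rw [cutNorm_congr fun x hx y hy => hBτ σ τ x hx y (hT hy)]
  conv_lhs => rw [← map_subtype_eq hT, cutNorm_map_right]
  refine cutNorm_congr fun x _ y _ => ?_
  simp

theorem expect_colourPerms_abs_sum_le {p : V → κ} {S : Finset α} {T Y : Finset V}
    (hY : ∀ y ∈ Y, ∀ y' ∈ Y, p y = p y') (hT : T ⊆ Y) (B : Equiv.Perm V → α → V → ℝ)
    (hB : ∀ σ x y, |B σ x y| ≤ 1)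
    (hBτ : ∀ σ (τ : Equiv.Perm Y), ∀ x ∈ S, ∀ y ∈ Y, B (σ * Equiv.Perm.ofSubtype τ) x y =
      B σ x (Equiv.Perm.ofSubtype τ y)) :
    𝔼 σ ∈ colourPerms p, |∑ x ∈ S, ∑ y ∈ T, B σ x y| ≤
      (T.card : ℝ) / Y.card * (𝔼 σ ∈ colourPerms p, |∑ x ∈ S, ∑ y ∈ Y, B σ x y|) +
        2 * (S.card * √(T.card : ℝ)) := by
  rw [expect_colourPerms_eq hY, Finset.mul_expect]
  rw [← Finset.expect_const (colourPerms_nonempty p) (2 * (S.card * √(T.card : ℝ))),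
    ← Finset.expect_add_distrib]
  refine Finset.expect_le_expect fun σ _ => ?_
  have key := expect_perm_abs_sum_le (fun x (y : Y) => B σ x y) (fun x y => hB σ x y) S
    (T.subtype (· ∈ Y))
  rw [card_subtype_of_subset hT, Fintype.card_coe] at key
  have h1 : ∑ x ∈ S, ∑ y : Y, B σ x y = ∑ x ∈ S, ∑ y ∈ Y, B σ x y :=
    Finset.sum_congr rfl fun x _ => Finset.sum_coe_sort Y (B σ x)
  rw [h1] at key
  refine le_trans (le_of_eq ?_) key
  refine Finset.expect_congr rfl fun τ _ => congrArg _ (Finset.sum_congr rfl fun x hx => ?_)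
  rw [Finset.sum_congr rfl fun y hy => hBτ σ τ x hx y (hT hy)]
  conv_lhs => rw [← map_subtype_eq hT, Finset.sum_map]
  simp

end ColourPreserving

namespace SimpleGraph

/-! ### Irregularity as the cut norm of a shifted adjacency matrix. -/

section PairIrreg

variable {V : Type*} (G : SimpleGraph V) [DecidableRel G.Adj]

/-- The adjacency matrix of `G`, shifted by `d`. -/
noncomputable def shiftedAdj (d : ℝ) (x y : V) : ℝ := (if G.Adj x y then 1 else 0) - d

theorem abs_shiftedAdj_le {d : ℝ} (h0 : 0 ≤ d) (h1 : d ≤ 1) (x y : V) :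
    |G.shiftedAdj d x y| ≤ 1 := by
  unfold shiftedAdj
  split_ifs <;> rw [abs_le] <;> constructor <;> linarith

theorem sum_shiftedAdj (d : ℝ) (U W : Finset V) :
    ∑ x ∈ U, ∑ y ∈ W, G.shiftedAdj d x y =
      ((G.interedges U W).card : ℝ) - (U.card : ℝ) * W.card * d := by
  simp only [shiftedAdj, Finset.sum_sub_distrib, Finset.sum_const, nsmul_eq_mul]
  rw [interedges_def, Finset.card_filter, Finset.sum_product]
  push_cast
  ring

theorem edgeDensity_mul_card {X Y : Finset V} (hX : X.Nonempty) (hY : Y.Nonempty) :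
    (X.card : ℝ) * Y.card * ((G.edgeDensity X Y : ℚ) : ℝ) = (G.interedges X Y).card := by
  have h1 : (X.card : ℝ) ≠ 0 := by exact_mod_cast hX.card_pos.ne'
  have h2 : (Y.card : ℝ) ≠ 0 := by exact_mod_cast hY.card_pos.ne'
  rw [edgeDensity_def]
  push_cast
  field_simp

theorem edgeDensity_cast_nonneg (X Y : Finset V) : (0 : ℝ) ≤ ((G.edgeDensity X Y : ℚ) : ℝ) := by
  exact_mod_cast G.edgeDensity_nonneg X Y

theorem edgeDensity_cast_le_one (X Y : Finset V) : ((G.edgeDensity X Y : ℚ) : ℝ) ≤ 1 := by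
  exact_mod_cast G.edgeDensity_le_one X Y

theorem pairIrreg_eq_cutNorm (X Y : Finset V) :
    G.pairIrreg X Y = cutNorm (G.shiftedAdj ((G.edgeDensity X Y : ℚ) : ℝ)) X Y := by
  unfold pairIrreg cutNorm
  simp only [sum_shiftedAdj]

theorem pairIrreg_nonneg (X Y : Finset V) : 0 ≤ G.pairIrreg X Y := by
  rw [pairIrreg_eq_cutNorm]
  exact cutNorm_nonneg _ _ _

/-- With `N = |X||Y|` and `u = |U||W|`, the count `e(U, W)` lies between `max(0, u - (1 - d)N)` and
`min(u, dN)`, so it deviates from `ud` by at most `d(1 - d)N`. -/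
theorem pairIrreg_le_quarter [DecidableEq V] {X Y : Finset V} (hX : X.Nonempty)
    (hY : Y.Nonempty) : G.pairIrreg X Y ≤ (X.card : ℝ) * Y.card / 4 := by
  rw [pairIrreg_eq_cutNorm]
  refine cutNorm_le fun U hU W hW => ?_
  rw [sum_shiftedAdj]
  have hd := G.edgeDensity_mul_card hX hY
  have hd0 := G.edgeDensity_cast_nonneg X Y
  have hd1 := G.edgeDensity_cast_le_one X Y
  set d : ℝ := ((G.edgeDensity X Y : ℚ) : ℝ)
  have h1 : ((G.interedges U W).card : ℝ) ≤ (U.card : ℝ) * W.card := by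
    exact_mod_cast G.card_interedges_le_mul U W
  have h2 : ((G.interedges U W).card : ℝ) ≤ (G.interedges X Y).card := by
    exact_mod_cast Finset.card_le_card (G.interedges_mono hU hW)
  have h3 : ((G.interedges X Y).card : ℝ) - (G.interedges U W).card ≤
      (X.card : ℝ) * Y.card - (U.card : ℝ) * W.card := by
    have hsub : G.interedges X Y \ G.interedges U W ⊆ (X ×ˢ Y) \ (U ×ˢ W) := by
      intro ⟨x, y⟩ h
      simp only [Finset.mem_sdiff, mk_mem_interedges_iff, Finset.mem_product] at h ⊢
      tauto
    have h4 := Finset.card_le_card hsub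
    have h5 := Finset.card_sdiff_add_card_eq_card (G.interedges_mono hU hW)
    have h6 := Finset.card_sdiff_add_card_eq_card (Finset.product_subset_product hU hW)
    rw [Finset.card_product, Finset.card_product] at h6
    have h5' : ((G.interedges X Y \ G.interedges U W).card : ℝ) + (G.interedges U W).card =
      (G.interedges X Y).card := by exact_mod_cast h5
    have h6' : (((X ×ˢ Y) \ (U ×ˢ W)).card : ℝ) + (U.card : ℝ) * W.card =
      (X.card : ℝ) * Y.card := by exact_mod_cast h6
    have h4' : ((G.interedges X Y \ G.interedges U W).card : ℝ) ≤
      ((X ×ˢ Y) \ (U ×ˢ W)).card := by exact_mod_cast h4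
    linarith
  have hN : 0 ≤ (X.card : ℝ) * Y.card := by positivity
  have hu : 0 ≤ (U.card : ℝ) * W.card := by positivity
  have he : (0 : ℝ) ≤ (G.interedges U W).card := by positivity
  generalize ((G.interedges U W).card : ℝ) = e at *
  generalize (U.card : ℝ) * W.card = u at *
  rw [← hd] at h2 h3
  generalize (X.card : ℝ) * Y.card = N at *
  have hq : N * (d * (1 - d)) ≤ N / 4 := by nlinarith [sq_nonneg (2 * d - 1)]
  rw [abs_le]
  constructor
  · rcases le_total (N * d + u) N with h | h
    · nlinarith
    · nlinarith
  · rcases le_total u (N * d) with h | h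
    · nlinarith
    · nlinarith

/-- A sampled pair need not have the density `d` of its parent pair. Recentring subtracts the
fraction `|U||W|/(|X||Y|) ≤ 1` of the total discrepancy. -/
theorem pairIrreg_le_cutNorm_add {X Y : Finset V} (hX : X.Nonempty) (hY : Y.Nonempty) (d : ℝ) :
    G.pairIrreg X Y ≤ cutNorm (G.shiftedAdj d) X Y +
      |∑ x ∈ X, ∑ y ∈ Y, G.shiftedAdj d x y| := by
  rw [pairIrreg_eq_cutNorm]
  refine cutNorm_le fun U hU W hW => ?_
  have h1 := le_cutNorm (G.shiftedAdj d) hU hW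
  have hd := G.edgeDensity_mul_card hX hY
  set d' : ℝ := ((G.edgeDensity X Y : ℚ) : ℝ)
  have hN : 0 < (X.card : ℝ) * Y.card :=
    mul_pos (by exact_mod_cast hX.card_pos) (by exact_mod_cast hY.card_pos)
  have hu : (U.card : ℝ) * W.card ≤ (X.card : ℝ) * Y.card := by
    exact_mod_cast Nat.mul_le_mul (Finset.card_le_card hU) (Finset.card_le_card hW)
  have h2 : ∑ x ∈ U, ∑ y ∈ W, G.shiftedAdj d' x y = ∑ x ∈ U, ∑ y ∈ W, G.shiftedAdj d x y -
      ((U.card : ℝ) * W.card) / ((X.card : ℝ) * Y.card) *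
        ∑ x ∈ X, ∑ y ∈ Y, G.shiftedAdj d x y := by
    simp only [sum_shiftedAdj]
    rw [← hd]
    field_simp
    ring
  rw [h2]
  refine (abs_sub _ _).trans (add_le_add h1 ?_)
  rw [abs_mul, abs_of_nonneg (div_nonneg (by positivity) hN.le)]
  exact mul_le_of_le_one_left (abs_nonneg _) ((div_le_one hN).2 hu)

end PairIrreg

/-! ### Random copies of a pair of parts. -/

section Sampling

variable {V κ : Type*} [DecidableEq V]

theorem ofSubtype_apply_of_disjoint {S Y : Finset V} (h : Disjoint S Y) (τ : Equiv.Perm Y) {x : V}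
    (hx : x ∈ S) : Equiv.Perm.ofSubtype τ x = x :=
  Equiv.Perm.ofSubtype_apply_of_not_mem τ (Finset.disjoint_left.1 h hx)

variable [Fintype V] [DecidableEq κ] (G : SimpleGraph V) [DecidableRel G.Adj]

theorem map_eq_of_mem_colourPerms {p : V → κ} {X : Finset V} {c : κ} (hX : ∀ v, v ∈ X ↔ p v = c)
    {σ : Equiv.Perm V} (hσ : σ ∈ colourPerms p) : X.map σ.toEmbedding = X := by
  apply Finset.eq_of_subset_of_card_le _ (by simp)
  intro v hv
  obtain ⟨x, hx, rfl⟩ := Finset.mem_map.1 hv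
  simp only [colourPerms, Finset.mem_filter, Finset.mem_univ, true_and] at hσ
  exact (hX _).2 ((hσ x).trans ((hX x).1 hx))

/-- Two-stage exposure: `S` is sampled from `X` against all of `Y`, then `T` from `Y \ S` with the
image of `S` held fixed. Removing `S` covers the case `X = Y`, and monotonicity of the cut norm
returns from `Y \ S` to `Y`. -/
theorem expect_cutNorm_map_le {p : V → κ} {S T X Y : Finset V} {c c' : κ}
    (hX : ∀ v, v ∈ X ↔ p v = c) (hY : ∀ v, v ∈ Y ↔ p v = c') (hS : S ⊆ X) (hT : T ⊆ Y)
    (hST : Disjoint S T) (A : V → V → ℝ) (hA : ∀ x y, |A x y| ≤ 1) :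
    𝔼 σ ∈ colourPerms p, cutNorm A (S.map σ.toEmbedding) (T.map σ.toEmbedding) ≤
      (T.card : ℝ) / (Y \ S).card * ((S.card : ℝ) / X.card * cutNorm A X Y +
        2 * (Y.card * √(S.card : ℝ))) + 2 * (S.card * √(T.card : ℝ)) := by
  have h1 := expect_colourPerms_cutNorm_le (p := p) (S := S) (T := T) (Y := Y \ S)
    (fun y hy y' hy' => ((hY y).1 (Finset.mem_sdiff.1 hy).1).trans
      ((hY y').1 (Finset.mem_sdiff.1 hy').1).symm)
    (Finset.subset_sdiff.2 ⟨hT, hST.symm⟩) (fun σ x y => A (σ x) (σ y)) (fun σ x y => hA _ _)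
    (fun σ τ x hx y _ => by
      simp only [Equiv.Perm.mul_apply]
      rw [ofSubtype_apply_of_disjoint Finset.disjoint_sdiff τ hx])
  have h2 := expect_colourPerms_cutNorm_le (p := p) (S := Y) (T := S) (Y := X)
    (fun y hy y' hy' => ((hX y).1 hy).trans ((hX y').1 hy').symm) hS
    (fun σ y x => A (σ x) y) (fun σ x y => hA _ _) (fun σ τ x hx y _ => rfl)
  have h3 : ∀ σ ∈ colourPerms p, cutNorm (fun y x => A (σ x) y) Y X = cutNorm A X Y := by
    intro σ hσ
    rw [cutNorm_transpose (fun x y => A (σ x) y)]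
    conv_rhs => rw [← map_eq_of_mem_colourPerms hX hσ, cutNorm_map_left]
    rfl
  rw [Finset.expect_congr rfl h3, Finset.expect_const (colourPerms_nonempty p)] at h2
  have h4 : 𝔼 σ ∈ colourPerms p, cutNorm (fun x y => A (σ x) (σ y)) S (Y \ S) ≤
      𝔼 σ ∈ colourPerms p, cutNorm (fun y x => A (σ x) y) Y S := by
    refine Finset.expect_le_expect fun σ hσ => ?_
    refine (cutNorm_mono_right _ _ Finset.sdiff_subset).trans (le_of_eq ?_)
    rw [cutNorm_transpose (fun x y => A (σ x) y)]
    conv_rhs => rw [← map_eq_of_mem_colourPerms hY hσ, cutNorm_map_right]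
    rfl
  have h5 : ∀ σ : Equiv.Perm V, cutNorm A (S.map σ.toEmbedding) (T.map σ.toEmbedding) =
      cutNorm (fun x y => A (σ x) (σ y)) S T := fun σ => by
    rw [cutNorm_map_left, cutNorm_map_right]; rfl
  simp only [h5]
  refine h1.trans (add_le_add (mul_le_mul_of_nonneg_left (h4.trans h2) (by positivity)) le_rfl)

/-- The same two stages, but an absolute sum is not monotone in the columns: passing between `Y \ S`
and `Y` costs up to `|S||S ∩ Y|`. The main term vanishes by `hA0`. -/
theorem expect_abs_sum_map_le {p : V → κ} {S T X Y : Finset V} {c c' : κ}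
    (hX : ∀ v, v ∈ X ↔ p v = c) (hY : ∀ v, v ∈ Y ↔ p v = c') (hS : S ⊆ X) (hT : T ⊆ Y)
    (hST : Disjoint S T) (A : V → V → ℝ) (hA : ∀ x y, |A x y| ≤ 1)
    (hA0 : ∑ x ∈ X, ∑ y ∈ Y, A x y = 0) :
    𝔼 σ ∈ colourPerms p, |∑ x ∈ S.map σ.toEmbedding, ∑ y ∈ T.map σ.toEmbedding, A x y| ≤
      (T.card : ℝ) / (Y \ S).card * (2 * (Y.card * √(S.card : ℝ)) + S.card * (S ∩ Y).card) +
        2 * (S.card * √(T.card : ℝ)) := by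
  have h1 := expect_colourPerms_abs_sum_le (p := p) (S := S) (T := T) (Y := Y \ S)
    (fun y hy y' hy' => ((hY y).1 (Finset.mem_sdiff.1 hy).1).trans
      ((hY y').1 (Finset.mem_sdiff.1 hy').1).symm)
    (Finset.subset_sdiff.2 ⟨hT, hST.symm⟩) (fun σ x y => A (σ x) (σ y)) (fun σ x y => hA _ _)
    (fun σ τ x hx y _ => by
      simp only [Equiv.Perm.mul_apply]
      rw [ofSubtype_apply_of_disjoint Finset.disjoint_sdiff τ hx])
  have h2 := expect_colourPerms_abs_sum_le (p := p) (S := Y) (T := S) (Y := X)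
    (fun y hy y' hy' => ((hX y).1 hy).trans ((hX y').1 hy').symm) hS
    (fun σ y x => A (σ x) y) (fun σ x y => hA _ _) (fun σ τ x hx y _ => rfl)
  have hmap : ∀ {Z : Finset V} {c : κ}, (∀ v, v ∈ Z ↔ p v = c) → ∀ σ ∈ colourPerms p,
      ∀ f : V → ℝ, ∑ x ∈ Z, f (σ x) = ∑ x ∈ Z, f x := fun hZ σ hσ f => by
    conv_rhs => rw [← map_eq_of_mem_colourPerms hZ hσ, Finset.sum_map]
    rfl
  have h3 : ∀ σ ∈ colourPerms p, |∑ y ∈ Y, ∑ x ∈ X, A (σ x) y| = 0 := by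
    intro σ hσ
    rw [Finset.sum_comm, hmap hX σ hσ fun x => ∑ y ∈ Y, A x y, hA0, abs_zero]
  rw [Finset.expect_congr rfl h3, Finset.expect_const (colourPerms_nonempty p), mul_zero,
    zero_add] at h2
  have h4 : 𝔼 σ ∈ colourPerms p, |∑ x ∈ S, ∑ y ∈ Y \ S, A (σ x) (σ y)| ≤
      𝔼 σ ∈ colourPerms p, (|∑ y ∈ Y, ∑ x ∈ S, A (σ x) y| + S.card * (S ∩ Y).card) := by
    refine Finset.expect_le_expect fun σ hσ => ?_
    have h5 : ∑ x ∈ S, ∑ y ∈ Y \ S, A (σ x) (σ y) = ∑ y ∈ Y, ∑ x ∈ S, A (σ x) y -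
        ∑ x ∈ S, ∑ y ∈ S ∩ Y, A (σ x) (σ y) := by
      rw [Finset.sum_comm (s := Y), ← Finset.sum_sub_distrib]
      refine Finset.sum_congr rfl fun x _ => ?_
      rw [← hmap hY σ hσ, Finset.inter_comm, ← Finset.sum_inter_add_sum_sdiff Y S]
      ring
    rw [h5]
    refine (abs_sub _ _).trans (add_le_add le_rfl ?_)
    refine (Finset.abs_sum_le_sum_abs _ _).trans ?_
    rw [← nsmul_eq_mul]
    refine Finset.sum_le_card_nsmul _ _ _ fun x _ => ?_
    refine (Finset.abs_sum_le_sum_abs _ _).trans ?_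
    refine (Finset.sum_le_card_nsmul _ _ 1 fun y _ => hA _ _).trans (by simp)
  rw [Finset.expect_add_distrib, Finset.expect_const (colourPerms_nonempty p)] at h4
  have h5 : ∀ σ : Equiv.Perm V,
      |∑ x ∈ S.map σ.toEmbedding, ∑ y ∈ T.map σ.toEmbedding, A x y| =
      |∑ x ∈ S, ∑ y ∈ T, A (σ x) (σ y)| := fun σ => by
    simp only [Finset.sum_map]; rfl
  simp only [h5]
  refine h1.trans (add_le_add (mul_le_mul_of_nonneg_left ?_ (by positivity)) le_rfl)
  exact h4.trans (add_le_add h2 le_rfl)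

theorem expect_pairIrreg_map_le {p : V → κ} {S T X Y : Finset V} {c c' : κ}
    (hX : ∀ v, v ∈ X ↔ p v = c) (hY : ∀ v, v ∈ Y ↔ p v = c') (hS : S ⊆ X) (hT : T ⊆ Y)
    (hST : Disjoint S T) (hS0 : S.Nonempty) (hT0 : T.Nonempty) :
    𝔼 σ ∈ colourPerms p, G.pairIrreg (S.map σ.toEmbedding) (T.map σ.toEmbedding) ≤
      (T.card : ℝ) / (Y \ S).card * ((S.card : ℝ) / X.card * G.pairIrreg X Y +
        4 * (Y.card * √(S.card : ℝ)) + S.card * (S ∩ Y).card) + 4 * (S.card * √(T.card : ℝ)) := by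
  set d : ℝ := ((G.edgeDensity X Y : ℚ) : ℝ) with hd
  have hA := G.abs_shiftedAdj_le (G.edgeDensity_cast_nonneg X Y) (G.edgeDensity_cast_le_one X Y)
  have h1 := expect_cutNorm_map_le hX hY hS hT hST _ hA
  have h2 := expect_abs_sum_map_le hX hY hS hT hST _ hA (by
    rw [sum_shiftedAdj, edgeDensity_mul_card _ (hS0.mono hS) (hT0.mono hT), sub_self])
  rw [← pairIrreg_eq_cutNorm] at h1
  have h3 : 𝔼 σ ∈ colourPerms p, G.pairIrreg (S.map σ.toEmbedding) (T.map σ.toEmbedding) ≤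
      𝔼 σ ∈ colourPerms p, (cutNorm (G.shiftedAdj d) (S.map σ.toEmbedding) (T.map σ.toEmbedding) +
      |∑ x ∈ S.map σ.toEmbedding, ∑ y ∈ T.map σ.toEmbedding, G.shiftedAdj d x y|) :=
    Finset.expect_le_expect fun σ _ => G.pairIrreg_le_cutNorm_add (hS0.map) (hT0.map) d
  rw [Finset.expect_add_distrib] at h3
  refine (h3.trans (add_le_add h1 h2)).trans (le_of_eq ?_)
  ring

end Sampling

end SimpleGraph

/-! ### Summing over all pairs of parts of the shuffled partition. -/

namespace SimpleGraph

section PairBound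

variable {V : Type*} [DecidableEq V] (G : SimpleGraph V) [DecidableRel G.Adj]

/-- The bound for the expected irregularity of a random copy of the pair `(S, T)`. -/
noncomputable def pairBound (S T X Y : Finset V) : ℝ :=
  (T.card : ℝ) / (Y \ S).card * ((S.card : ℝ) / X.card * G.pairIrreg X Y +
    4 * (Y.card * √(S.card : ℝ)) + S.card * (S ∩ Y).card) + 4 * (S.card * √(T.card : ℝ))

theorem pairBound_nonneg (S T X Y : Finset V) : 0 ≤ G.pairBound S T X Y := by
  have := G.pairIrreg_nonneg X Y
  unfold pairBound
  positivity

end PairBound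

section Equitable

theorem sum_card_le_of_subset {V : Type*} [DecidableEq V] {a : Finset V} (Q : Finpartition a) {𝒮 : Finset (Finset V)}
    (h𝒮 : 𝒮 ⊆ Q.parts) {Z : Finset V} (hZ : ∀ S ∈ 𝒮, S ⊆ Z) : ∑ S ∈ 𝒮, S.card ≤ Z.card := by
  have h := Finset.card_biUnion (t := id) fun S hS T hT h => Q.disjoint (h𝒮 hS) (h𝒮 hT) h
  exact h.symm.trans_le (Finset.card_le_card (Finset.biUnion_subset.2 hZ))

variable {V : Type*} [Fintype V] [DecidableEq V]

/-- The image of a partition of the vertex set under a permutation. -/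
def mapPerm (σ : Equiv.Perm V) (Q : Finpartition (Finset.univ : Finset V)) :
    Finpartition (Finset.univ : Finset V) :=
  (Q.map (β := Finset V) ⟨σ.finsetCongr, Finset.map_subset_map⟩).copy
    (Finset.map_univ_equiv σ)

theorem mapPerm_parts (σ : Equiv.Perm V) (Q : Finpartition (Finset.univ : Finset V)) :
    (mapPerm σ Q).parts = Q.parts.map (Finset.mapEmbedding σ.toEmbedding).toEmbedding := rfl

theorem partitionIrreg_mapPerm (G : SimpleGraph V) [DecidableRel G.Adj] (σ : Equiv.Perm V)
    (Q : Finpartition (Finset.univ : Finset V)) :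
    G.partitionIrreg (mapPerm σ Q) = ∑ S ∈ Q.parts, ∑ T ∈ Q.parts,
      G.pairIrreg (S.map σ.toEmbedding) (T.map σ.toEmbedding) := by
  simp [partitionIrreg, mapPerm_parts]

theorem mapPerm_isEquipartition (σ : Equiv.Perm V) {Q : Finpartition (Finset.univ : Finset V)}
    {s : ℕ} (h : ∀ S ∈ Q.parts, S.card = s ∨ S.card = s + 1) :
    (mapPerm σ Q).IsEquipartition := by
  refine Set.equitableOn_iff_exists_eq_eq_add_one.2 ⟨s, fun S hS => ?_⟩
  rw [Finset.mem_coe, mapPerm_parts] at hS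
  obtain ⟨T, hT, rfl⟩ := Finset.mem_map.1 hS
  simpa using h T hT

theorem sum_card_parts_cast (Q : Finpartition (Finset.univ : Finset V)) :
    ∑ S ∈ Q.parts, (S.card : ℝ) = Fintype.card V := by
  exact_mod_cast Q.sum_card_parts

/-- The parts of `Q` that are not contained in a part of `P` cover few vertices if the parts of
`Q` inside each part of `P` leave few vertices uncovered. -/
theorem sum_card_not_subset_le (P Q : Finpartition (Finset.univ : Finset V)) (s : ℕ)
    (h : ∀ X ∈ P.parts, (X \ (Q.parts.filter (· ⊆ X)).biUnion id).card ≤ s) :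
    ∑ S ∈ Q.parts with ¬ ∃ X ∈ P.parts, S ⊆ X, S.card ≤ P.parts.card * s := by
  refine (sum_card_le_of_subset Q (Finset.filter_subset _ _)
    (Z := P.parts.biUnion fun X => X \ (Q.parts.filter (· ⊆ X)).biUnion id) ?_).trans
    (Finset.card_biUnion_le.trans ((Finset.sum_le_card_nsmul _ _ _ h).trans_eq (by simp)))
  intro S hS v hv
  obtain ⟨hSQ, hSP⟩ := Finset.mem_filter.1 hS
  obtain ⟨X, hX, hvX⟩ := P.exists_mem (Finset.mem_univ v)
  refine Finset.mem_biUnion.2 ⟨X, hX, Finset.mem_sdiff.2 ⟨hvX, fun hv' => hSP ⟨X, hX, ?_⟩⟩⟩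
  obtain ⟨T, hT, hvT⟩ := Finset.mem_biUnion.1 hv'
  obtain ⟨hTQ, hTX⟩ := Finset.mem_filter.1 hT
  rwa [Q.eq_of_mem_parts hSQ hTQ hv hvT]

variable (G : SimpleGraph V) [DecidableRel G.Adj]

/-- The denominator `|Y \ S|` costs nothing: the parts `T ≠ S` inside `Y` are disjoint subsets of `Y
\ S`, so their weights add up to at most 1. -/
theorem sum_pairBound_le (Q : Finpartition (Finset.univ : Finset V)) (s : ℕ) (δ : ℝ)
    (hQ : ∀ S ∈ Q.parts, S.card ≤ s + 1 ∧ √(S.card : ℝ) ≤ δ * S.card) (hδ : 0 ≤ δ)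
    (X Y : Finset V) :
    ∑ S ∈ Q.parts with S ⊆ X, ∑ T ∈ Q.parts with T ⊆ Y ∧ S ≠ T, G.pairBound S T X Y ≤
      G.pairIrreg X Y + 8 * δ * (X.card * Y.card) + (s + 1) * (X ∩ Y).card := by
  have hirr := G.pairIrreg_nonneg X Y
  have h1 : ∀ S ∈ Q.parts.filter (· ⊆ X),
      ∑ T ∈ Q.parts with T ⊆ Y ∧ S ≠ T, G.pairBound S T X Y ≤
        (S.card : ℝ) / X.card * G.pairIrreg X Y + 8 * δ * Y.card * S.card +
          (s + 1) * (S ∩ Y).card := by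
    intro S hS
    have hSQ := (Finset.mem_filter.1 hS).1
    obtain ⟨hs1, hs2⟩ := hQ S hSQ
    have hs1' : (S.card : ℝ) ≤ s + 1 := by exact_mod_cast hs1
    unfold pairBound
    rw [Finset.sum_add_distrib, ← Finset.sum_mul, ← Finset.sum_div, ← Finset.mul_sum,
      ← Finset.mul_sum]
    have hT : ∑ T ∈ Q.parts with T ⊆ Y ∧ S ≠ T, (T.card : ℝ) ≤ (Y \ S).card := by
      exact_mod_cast sum_card_le_of_subset Q (Finset.filter_subset _ _) fun T hT => by
        obtain ⟨hTQ, hTY, hne⟩ := Finset.mem_filter.1 hT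
        exact Finset.subset_sdiff.2 ⟨hTY, Q.disjoint hTQ hSQ (Ne.symm hne)⟩
    have hT1 : (∑ T ∈ Q.parts with T ⊆ Y ∧ S ≠ T, (T.card : ℝ)) / (Y \ S).card ≤ 1 :=
      div_le_one_of_le₀ hT (by positivity)
    have hT2 : ∑ T ∈ Q.parts with T ⊆ Y ∧ S ≠ T, √(T.card : ℝ) ≤ δ * Y.card := by
      refine (Finset.sum_le_sum fun T hT => (hQ T (Finset.mem_filter.1 hT).1).2).trans ?_
      rw [← Finset.mul_sum]
      refine mul_le_mul_of_nonneg_left (hT.trans ?_) hδ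
      exact_mod_cast Finset.card_le_card Finset.sdiff_subset
    have e1 := mul_le_mul_of_nonneg_right hT1 (by positivity :
      0 ≤ (S.card : ℝ) / X.card * G.pairIrreg X Y +
        4 * (Y.card * √(S.card : ℝ)) + S.card * (S ∩ Y).card)
    have e2 := mul_le_mul_of_nonneg_left hT2 (by positivity : (0 : ℝ) ≤ S.card)
    have e3 := mul_le_mul_of_nonneg_left hs2 (by positivity : (0 : ℝ) ≤ Y.card)
    have e4 := mul_le_mul_of_nonneg_right hs1' (by positivity : (0 : ℝ) ≤ (S ∩ Y).card)
    nlinarith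
  refine (Finset.sum_le_sum h1).trans ?_
  rw [Finset.sum_add_distrib, Finset.sum_add_distrib, ← Finset.sum_mul, ← Finset.sum_div,
    ← Finset.mul_sum, ← Finset.mul_sum]
  have hS : ∑ S ∈ Q.parts with S ⊆ X, (S.card : ℝ) ≤ X.card := by
    exact_mod_cast sum_card_le_of_subset Q (Finset.filter_subset _ _) fun S hS =>
      (Finset.mem_filter.1 hS).2
  have hS1 := mul_le_mul_of_nonneg_right (div_le_one_of_le₀ hS (by positivity)) hirr
  have hS2 := mul_le_mul_of_nonneg_left hS (by positivity : 0 ≤ 8 * δ * Y.card)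
  have hS3 : ∑ S ∈ Q.parts with S ⊆ X, ((S ∩ Y).card : ℝ) ≤ (X ∩ Y).card := by
    have hd : ((Q.parts.filter (· ⊆ X) : Finset (Finset V)) : Set (Finset V)).PairwiseDisjoint
        fun S => S ∩ Y := fun S hS T hT hne =>
      (Q.disjoint (Finset.mem_filter.1 hS).1 (Finset.mem_filter.1 hT).1 hne).mono
        Finset.inter_subset_left Finset.inter_subset_left
    have h2 := Finset.card_biUnion hd
    have h3 : (Q.parts.filter (· ⊆ X)).biUnion (fun S => S ∩ Y) ⊆ X ∩ Y :=
      Finset.biUnion_subset.2 fun S hS =>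
        Finset.inter_subset_inter_right (Finset.mem_filter.1 hS).2
    exact_mod_cast h2 ▸ Finset.card_le_card h3
  have hS4 := mul_le_mul_of_nonneg_left hS3 (by positivity : (0 : ℝ) ≤ s + 1)
  nlinarith

/-- The expected irregularity of a random copy of `Q` under the permutations preserving `P`. -/
theorem expect_partitionIrreg_mapPerm_le (P Q : Finpartition (Finset.univ : Finset V)) (s : ℕ)
    (δ : ℝ) (hQ : ∀ S ∈ Q.parts, S.card ≤ s + 1 ∧ √(S.card : ℝ) ≤ δ * S.card) (hδ : 0 ≤ δ)
    (h : ∀ X ∈ P.parts, (X \ (Q.parts.filter (· ⊆ X)).biUnion id).card ≤ s) :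
    𝔼 σ ∈ colourPerms P.part, G.partitionIrreg (mapPerm σ Q) ≤
      G.partitionIrreg P + 8 * δ * (Fintype.card V : ℝ) ^ 2 +
        5 / 4 * (s + 1) * Fintype.card V + P.parts.card * s * Fintype.card V / 2 := by
  classical
  simp only [partitionIrreg_mapPerm, Finset.expect_sum_comm]
  set n : ℝ := (Fintype.card V : ℝ)
  have hmem : ∀ X ∈ P.parts, ∀ v, v ∈ X ↔ P.part v = X := fun X hX v => (P.part_eq_iff_mem hX).symm
  have htriv : ∀ S ∈ Q.parts, ∀ T ∈ Q.parts,
      𝔼 σ ∈ colourPerms P.part, G.pairIrreg (S.map σ.toEmbedding) (T.map σ.toEmbedding) ≤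
        (S.card : ℝ) * T.card / 4 := fun S hS T hT => by
    rw [← Finset.expect_const (colourPerms_nonempty P.part) ((S.card : ℝ) * T.card / 4)]
    refine Finset.expect_le_expect fun σ _ => ?_
    simpa using G.pairIrreg_le_quarter ((Q.nonempty_of_mem_parts hS).map (f := σ.toEmbedding))
      ((Q.nonempty_of_mem_parts hT).map (f := σ.toEmbedding))
  -- Bad parts straddle `P`. They cover at most `s` vertices per part of `P`, so the quarter bound
  -- is affordable for pairs that involve one.
  let bad : Finset V → Prop := fun S => ¬ ∃ X ∈ P.parts, S ⊆ X
  let b : Finset V → ℝ := fun S => if bad S then (S.card : ℝ) else 0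
  have hb0 : ∀ S, 0 ≤ b S := fun S => by simp only [b]; split_ifs <;> positivity
  have hpair : ∀ S ∈ Q.parts, ∀ T ∈ Q.parts,
      𝔼 σ ∈ colourPerms P.part, G.pairIrreg (S.map σ.toEmbedding) (T.map σ.toEmbedding) ≤
        (∑ X ∈ P.parts, ∑ Y ∈ P.parts,
          if S ⊆ X ∧ T ⊆ Y ∧ S ≠ T then G.pairBound S T X Y else 0) +
        ((if S = T then (S.card : ℝ) * T.card / 4 else 0) +
          (b S * T.card / 4 + S.card * b T / 4)) := by
    intro S hS T hT
    have hn : ∀ X Y : Finset V, 0 ≤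
        (if S ⊆ X ∧ T ⊆ Y ∧ S ≠ T then G.pairBound S T X Y else 0) := fun X Y => by
      split_ifs
      · exact G.pairBound_nonneg S T X Y
      · exact le_rfl
    have hn1 : 0 ≤ ∑ X ∈ P.parts, ∑ Y ∈ P.parts,
        (if S ⊆ X ∧ T ⊆ Y ∧ S ≠ T then G.pairBound S T X Y else 0) :=
      Finset.sum_nonneg fun X _ => Finset.sum_nonneg fun Y _ => hn X Y
    have hn2 : 0 ≤ (if S = T then (S.card : ℝ) * T.card / 4 else 0) := by
      split_ifs <;> positivity
    have hn3 : 0 ≤ b S * T.card / 4 := by have := hb0 S; positivity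
    have hn4 : 0 ≤ S.card * b T / 4 := by have := hb0 T; positivity
    have ht := htriv S hS T hT
    by_cases hST : S = T
    · rw [if_pos hST]; linarith
    by_cases hbS : bad S
    · have : b S = S.card := if_pos hbS
      rw [this] at hn3 ⊢; linarith
    by_cases hbT : bad T
    · have : b T = T.card := if_pos hbT
      rw [this] at hn4 ⊢; linarith
    obtain ⟨X, hX, hSX⟩ := not_not.1 hbS
    obtain ⟨Y, hY, hTY⟩ := not_not.1 hbT
    have h1 := G.expect_pairIrreg_map_le (hmem X hX) (hmem Y hY) hSX hTY (Q.disjoint hS hT hST)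
      (Q.nonempty_of_mem_parts hS) (Q.nonempty_of_mem_parts hT)
    have h2 : G.pairBound S T X Y ≤ ∑ X ∈ P.parts, ∑ Y ∈ P.parts,
        (if S ⊆ X ∧ T ⊆ Y ∧ S ≠ T then G.pairBound S T X Y else 0) := by
      refine le_trans ?_ (Finset.single_le_sum
        (fun X _ => Finset.sum_nonneg fun Y _ => hn X Y) hX)
      refine le_trans ?_ (Finset.single_le_sum (fun Y _ => hn X Y) hY)
      rw [if_pos ⟨hSX, hTY, hST⟩]
    have h3 := h1.trans h2
    linarith
  refine (Finset.sum_le_sum fun S hS => Finset.sum_le_sum fun T hT => hpair S hS T hT).trans ?_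
  simp only [Finset.sum_add_distrib]
  have hsum : ∑ S ∈ Q.parts, (S.card : ℝ) = n := sum_card_parts_cast Q
  have hsumP : ∑ X ∈ P.parts, (X.card : ℝ) = n := sum_card_parts_cast P
  have hbsum : ∑ S ∈ Q.parts, b S ≤ P.parts.card * s := by
    rw [← Finset.sum_filter]
    exact_mod_cast sum_card_not_subset_le P Q s h
  have hn0 : 0 ≤ n := by positivity
  have hgood : ∑ S ∈ Q.parts, ∑ T ∈ Q.parts, ∑ X ∈ P.parts, ∑ Y ∈ P.parts,
      (if S ⊆ X ∧ T ⊆ Y ∧ S ≠ T then G.pairBound S T X Y else 0) ≤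
      G.partitionIrreg P + 8 * δ * n ^ 2 + (s + 1) * n := by
    have hswap : ∑ S ∈ Q.parts, ∑ T ∈ Q.parts, ∑ X ∈ P.parts, ∑ Y ∈ P.parts,
        (if S ⊆ X ∧ T ⊆ Y ∧ S ≠ T then G.pairBound S T X Y else 0) =
        ∑ X ∈ P.parts, ∑ Y ∈ P.parts, ∑ S ∈ Q.parts with S ⊆ X,
          ∑ T ∈ Q.parts with T ⊆ Y ∧ S ≠ T, G.pairBound S T X Y := by
      rw [Finset.sum_congr rfl fun S _ => Finset.sum_comm, Finset.sum_comm]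
      refine Finset.sum_congr rfl fun X _ => ?_
      rw [Finset.sum_congr rfl fun S _ => Finset.sum_comm, Finset.sum_comm]
      refine Finset.sum_congr rfl fun Y _ => ?_
      rw [Finset.sum_filter]
      refine Finset.sum_congr rfl fun S _ => ?_
      rw [Finset.sum_filter]
      split_ifs with hSX <;> simp [hSX]
    rw [hswap]
    refine (Finset.sum_le_sum fun X _ => Finset.sum_le_sum fun Y _ =>
      G.sum_pairBound_le Q s δ hQ hδ X Y).trans (le_of_eq ?_)
    simp only [Finset.sum_add_distrib, ← Finset.mul_sum, hsumP, ← Finset.sum_mul]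
    have hinter : ∑ X ∈ P.parts, ∑ Y ∈ P.parts, ((X ∩ Y).card : ℝ) = n := by
      rw [← hsumP]
      refine Finset.sum_congr rfl fun X hX => ?_
      rw [Finset.sum_eq_single_of_mem X hX, Finset.inter_self]
      intro Y hY hne
      have hXY : X ∩ Y = ∅ := Finset.disjoint_iff_inter_eq_empty.1 (P.disjoint hX hY hne.symm)
      simp [hXY]
    rw [hinter, partitionIrreg]
    ring
  have hdiag : ∑ S ∈ Q.parts, ∑ T ∈ Q.parts,
      (if S = T then (S.card : ℝ) * T.card / 4 else 0) ≤ (s + 1) * n / 4 := by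
    rw [← hsum, Finset.mul_sum, Finset.sum_div]
    refine Finset.sum_le_sum fun S hS => ?_
    rw [Finset.sum_ite_eq, if_pos hS]
    have : (S.card : ℝ) ≤ s + 1 := by exact_mod_cast (hQ S hS).1
    gcongr
  have hbad1 : ∑ S ∈ Q.parts, ∑ T ∈ Q.parts, b S * T.card / 4 ≤ P.parts.card * s * n / 4 := by
    simp only [← Finset.sum_div, ← Finset.mul_sum, hsum, ← Finset.sum_mul]
    gcongr
  have hbad2 : ∑ S ∈ Q.parts, ∑ T ∈ Q.parts, S.card * b T / 4 ≤ P.parts.card * s * n / 4 := by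
    simp only [← Finset.sum_div, ← Finset.mul_sum, ← Finset.sum_mul, hsum]
    rw [mul_comm n]
    gcongr
  linarith

end Equitable

end SimpleGraph

/-! ### Choice of parameters and conclusion. -/

theorem theorem2p1 {V : Type*} [Fintype V] [DecidableEq V]
    (G : SimpleGraph V) [DecidableRel G.Adj] (α : ℝ) (hα₀ : 0 < α) (hα₁ : α < 1 / 2)
    (m : ℕ) (hm : 1 ≤ m)
    (hn : (10 : ℝ) ^ 8 * (m : ℝ) * (α ^ 5)⁻¹ ≤ (Fintype.card V : ℝ))
    (P : Finpartition (Finset.univ : Finset V)) (hP : P.parts.card = m) :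
    ∃ Q : Finpartition (Finset.univ : Finset V),
      Q.IsEquipartition ∧
      (Q.parts.card : ℝ) ≤ 4 * (m : ℝ) / α ∧
      G.partitionIrreg Q ≤ G.partitionIrreg P + α * (Fintype.card V : ℝ) ^ 2 := by
  set N := Fintype.card V with hN
  set K := ⌊4 * (m : ℝ) / α⌋₊ with hK
  set s := N / K with hs
  have hm' : (1 : ℝ) ≤ m := by exact_mod_cast hm
  have hα2 : α ^ 2 ≤ 1 / 4 := by nlinarith
  have hα4 : α ^ 4 ≤ 1 / 16 := by nlinarith [sq_nonneg (α ^ 2), sq_nonneg α]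
  have hn' : (10 : ℝ) ^ 8 * m ≤ N * α ^ 5 := by
    rwa [← div_eq_mul_inv, div_le_iff₀ (by positivity)] at hn
  have hKle : (K : ℝ) ≤ 4 * m / α := Nat.floor_le (by positivity)
  have h8 : 8 ≤ 4 * (m : ℝ) / α := by rw [le_div_iff₀ hα₀]; nlinarith
  have hKge : 7 / 2 * (m : ℝ) / α ≤ K := by
    have h1 := (Nat.lt_floor_add_one (4 * (m : ℝ) / α)).le
    have h2 : 7 / 2 * (m : ℝ) / α = 7 / 8 * (4 * m / α) := by ring
    rw [h2]; linarith
  have hK7 : (7 : ℝ) ≤ K := by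
    have h2 : 7 / 2 * (m : ℝ) / α = 7 / 8 * (4 * m / α) := by ring
    linarith
  have hKpos : 0 < K := by
    have : (0 : ℝ) < K := by linarith
    exact_mod_cast this
  have hdm : K * s + N % K = N := Nat.div_add_mod N K
  have hmod : N % K < K := Nat.mod_lt N hKpos
  have hKs : (K : ℝ) * s ≤ N := by
    have : K * s ≤ N := by omega
    exact_mod_cast this
  have hKs' : (N : ℝ) ≤ K * (s + 1) := by
    have : N ≤ K * (s + 1) := by rw [mul_add]; omega
    exact_mod_cast this
  -- Since `4m/α ≥ 8`, rounding down loses at most a factor `7/8`, which turns `α/4` into `2α/7`.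
  have hms : (m : ℝ) * s ≤ 2 / 7 * α * N := by
    have h1 : 7 / 2 * (m : ℝ) ≤ K * α := by rwa [div_le_iff₀ hα₀] at hKge
    have h2 := mul_le_mul_of_nonneg_right h1 (by positivity : (0 : ℝ) ≤ s)
    have h3 := mul_le_mul_of_nonneg_right hKs hα₀.le
    nlinarith
  have hslow : (10 : ℝ) ^ 6 ≤ s * α ^ 4 := by
    have h1 : (K : ℝ) * α ≤ 4 * m := by rwa [le_div_iff₀ hα₀] at hKle
    have h2 : (10 : ℝ) ^ 8 * m ≤ 4 * m * ((s + 1) * α ^ 4) := by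
      calc (10 : ℝ) ^ 8 * m ≤ N * α ^ 5 := hn'
        _ ≤ K * (s + 1) * α ^ 5 := by gcongr
        _ = K * α * ((s + 1) * α ^ 4) := by ring
        _ ≤ 4 * m * ((s + 1) * α ^ 4) := by gcongr
    have h3 : (10 : ℝ) ^ 8 ≤ 4 * ((s + 1) * α ^ 4) := by
      by_contra hlt
      push Not at hlt
      nlinarith
    nlinarith
  have hspos : 0 < s := by
    rcases Nat.eq_zero_or_pos s with h | h
    · rw [h] at hslow; norm_num at hslow
    · exact h
  have hab : (K - N % K) * s + N % K * (s + 1) = (Finset.univ : Finset V).card := by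
    have h1 : (K - N % K) + N % K = K := Nat.sub_add_cancel hmod.le
    rw [Finset.card_univ, ← hN, mul_add, ← add_assoc, ← add_mul, h1, mul_one]
    exact hdm
  set Q := P.equitabilise hab with hQdef
  have hQs : ∀ S ∈ Q.parts, S.card = s ∨ S.card = s + 1 := fun S hS =>
    Finpartition.card_eq_of_mem_parts_equitabilise hS
  have hQK : Q.parts.card = K := by
    rw [hQdef, Finpartition.card_parts_equitabilise P hab hspos.ne']
    omega
  -- Taking `δ = α/100` requires parts of size at least `10⁴α⁻²`; the assumed size of `n` gives
  -- more.
  have hδ : ∀ S ∈ Q.parts, S.card ≤ s + 1 ∧ √(S.card : ℝ) ≤ α / 100 * S.card := by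
    intro S hS
    have hc := hQs S hS
    refine ⟨by omega, Real.sqrt_le_iff.2 ⟨by positivity, ?_⟩⟩
    have h1 : (s : ℝ) ≤ S.card := by
      have : s ≤ S.card := by omega
      exact_mod_cast this
    have h2 : (10 : ℝ) ^ 4 ≤ S.card * α ^ 2 := by
      have h3 : (s : ℝ) * α ^ 4 ≤ S.card * α ^ 2 := by
        have h4 : α ^ 4 ≤ α ^ 2 := by nlinarith [sq_nonneg α]
        gcongr
      linarith
    have h3 : (0 : ℝ) ≤ S.card := by positivity
    nlinarith
  have key := G.expect_partitionIrreg_mapPerm_le P Q s (α / 100) hδ (by positivity)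
    fun X hX => Finpartition.card_parts_equitabilise_subset_le P hab hX
  obtain ⟨σ, -, hσ⟩ := Finset.exists_le_of_expect_le (colourPerms_nonempty P.part) key
  refine ⟨SimpleGraph.mapPerm σ Q, SimpleGraph.mapPerm_isEquipartition σ hQs, ?_, ?_⟩
  · rw [SimpleGraph.mapPerm_parts, Finset.card_map, hQK]
    exact hKle
  · refine hσ.trans ?_
    rw [hP, ← hN]
    have h1 : (1 : ℝ) ≤ α * N / 10 ^ 6 := by
      rw [le_div_iff₀ (by norm_num)]
      have : α ^ 5 ≤ α := by nlinarith
      nlinarith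
    have hs' : (s : ℝ) ≤ m * s := le_mul_of_one_le_left (by positivity) hm'
    have hN0 : (0 : ℝ) ≤ N := by positivity
    have h2 := mul_le_mul_of_nonneg_right hms hN0
    have h3 := mul_le_mul_of_nonneg_right hs' hN0
    have h4 := mul_le_mul_of_nonneg_right h1 hN0
    -- In units of `αn²`, the budget is `8/100` for sampling, `5/4 · 2/7` for the diagonal and
    -- overlap terms, `1/7` for bad parts, and a negligible term from the `+ 1` in `s + 1`.
    nlinarith [mul_nonneg hα₀.le (sq_nonneg (N : ℝ))]
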